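/- Let $\mathcal G$ be the set of continuous nondecreasing functions $g:[0,1]\to\mathbb R$ with $g(0)=0$ and $g(1)=1$, and for $a,b,c>0$ let $$f_{a,b,c}(t)=\bigl(1-(1-t^a)^b\bigr)^c,\qquad t\in[0,1].$$ Then $$\sup_{g\in\mathcal G}\ \inf_{a,b,c>0}\ \int_0^1\bigl[f_{a,b,c}(t)-g(t)\bigr]^2\,dt\ \le\ \frac1{16}.$$ Moreover, for every $g\in\mathcal G$ there exist $a,b,c>0$ with $\int_0^1[f_{a,b,c}(t)-g(t)]^2\,dt\le\frac1{16}$. -/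

import Mathlib

/-- The generalized Kumaraswamy transformation `f_{a,b,c}(t) = (1 - (1 - t^a)^b)^c`
(real powers; used for `a, b, c > 0` and `t ∈ [0,1]`, where every base lies in `[0,1]`). -/
noncomputable def kumaraswamy (a b c t : ℝ) : ℝ :=
  (1 - (1 - t ^ a) ^ b) ^ c

/-- The class `𝒢` of continuous nondecreasing functions on `[0,1]` with `g 0 = 0` and `g 1 = 1`.
Only the values of `g` on `[0,1]` are constrained. -/
def monotoneClass : Set (ℝ → ℝ) :=
  {g | ContinuousOn g (Set.Icc 0 1) ∧ MonotoneOn g (Set.Icc 0 1) ∧ g 0 = 0 ∧ g 1 = 1}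

/-- The squared `L²([0,1])` error between the transformation and `g`. -/
noncomputable def kumaraswamyError (g : ℝ → ℝ) (a b c : ℝ) : ℝ :=
  ∫ t in (0 : ℝ)..1, (kumaraswamy a b c t - g t) ^ 2

/-!
A power `t ^ k` capped at `1` after multiplication by `A > 0` is a limit of Kumaraswamy
transformations, and so is a step function, so it suffices to fit `g` by one of these with squared
error less than `1 / 16`. View `g` as the distribution function of a random variable with
median `s`, let `u ≤ s ≤ v` be the means of its lower and upper halves, and let `h` be the total
dispersion of the two halves. Then `∫ g` and `∫ g ^ 2` are affine in `u`, `v`, `h`, the step at `s`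
has error `(v - u - h) / 4`, and a second mean value inequality bounds the moments `∫ t * g t` and
`∫ √t * g t` from below. If the step is not good enough, the constant `1 - (u + v) / 2` works when
`h > 2 * u`, a multiple of `√t` works when `h ≤ 2 * u` and `u ≤ 1 / 4`, and a multiple of `t` works
when `u ≥ 1 / 4`.
-/

open Set Filter Topology MeasureTheory

theorem kumaraswamy_mem_Icc {a b c t : ℝ} (ha : 0 ≤ a) (hb : 0 ≤ b) (hc : 0 ≤ c)
    (ht : t ∈ Icc (0 : ℝ) 1) : kumaraswamy a b c t ∈ Icc (0 : ℝ) 1 := by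
  have one_sub_rpow_mem {x p : ℝ} (hp : 0 ≤ p) (hx : x ∈ Icc (0 : ℝ) 1) :
      1 - x ^ p ∈ Icc (0 : ℝ) 1 :=
    ⟨sub_nonneg.2 (Real.rpow_le_one hx.1 hx.2 hp), sub_le_self _ (Real.rpow_nonneg hx.1 p)⟩
  have hbase := one_sub_rpow_mem hb (one_sub_rpow_mem ha ht)
  exact ⟨Real.rpow_nonneg hbase.1 c, Real.rpow_le_one hbase.1 hbase.2 hc⟩

theorem measurable_kumaraswamy (a b c : ℝ) : Measurable (kumaraswamy a b c) := by
  unfold kumaraswamy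
  fun_prop

theorem monotoneClass_apply_mem_Icc {g : ℝ → ℝ} (hg : g ∈ monotoneClass) {t : ℝ}
    (ht : t ∈ Icc (0 : ℝ) 1) : g t ∈ Icc (0 : ℝ) 1 := by
  obtain ⟨-, hmono, h0, h1⟩ := hg
  exact ⟨h0 ▸ hmono (by simp) ht ht.1, h1 ▸ hmono ht (by simp) ht.2⟩

/-- `F` is an almost everywhere limit on `(0, 1)` of Kumaraswamy transformations with positive
parameters. The parameters of a fit may degenerate, so the fits are compared with `g` only after
passing to such a limit. -/
def IsKumaraswamyLimit (F : ℝ → ℝ) : Prop :=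
  ∃ a b c : ℕ → ℝ, (∀ n, 0 < a n ∧ 0 < b n ∧ 0 < c n) ∧
    ∀ᵐ t, t ∈ Ioo (0 : ℝ) 1 →
      Tendsto (fun n => kumaraswamy (a n) (b n) (c n) t) atTop (𝓝 (F t))

theorem IsKumaraswamyLimit.exists_kumaraswamyError_lt {g F : ℝ → ℝ} (hF : IsKumaraswamyLimit F)
    (hg : g ∈ monotoneClass) {ε : ℝ} (hlt : ∫ t in (0 : ℝ)..1, (F t - g t) ^ 2 < ε) :
    ∃ a b c : ℝ, 0 < a ∧ 0 < b ∧ 0 < c ∧ kumaraswamyError g a b c < ε := by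
  obtain ⟨a, b, c, hpos, hlim⟩ := hF
  have herror : Tendsto (fun n => kumaraswamyError g (a n) (b n) (c n)) atTop
      (𝓝 (∫ t in (0 : ℝ)..1, (F t - g t) ^ 2)) := by
    refine intervalIntegral.tendsto_integral_filter_of_dominated_convergence (fun _ => 1)
      (.of_forall fun n => ?_) (.of_forall fun n => .of_forall fun t ht => ?_) (by simp) ?_
    · have hg_meas : AEStronglyMeasurable g (volume.restrict (uIoc (0 : ℝ) 1)) := by
        rw [uIoc_of_le zero_le_one]
        exact (hg.1.mono Ioc_subset_Icc_self).aestronglyMeasurable measurableSet_Ioc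
      exact ((measurable_kumaraswamy _ _ _).aestronglyMeasurable.sub hg_meas).pow 2
    · rw [uIoc_of_le zero_le_one] at ht
      have hf := kumaraswamy_mem_Icc (hpos n).1.le (hpos n).2.1.le (hpos n).2.2.le
        (Ioc_subset_Icc_self ht)
      have hg := monotoneClass_apply_mem_Icc hg (Ioc_subset_Icc_self ht)
      rw [Real.norm_of_nonneg (sq_nonneg _), sq_le_one_iff_abs_le_one, abs_le]
      exact ⟨by linarith [hf.1, hg.2], by linarith [hf.2, hg.1]⟩
    · filter_upwards [hlim, Measure.ae_ne volume (1 : ℝ)] with t hlim ht1 ht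
      rw [uIoc_of_le zero_le_one] at ht
      exact ((hlim ⟨ht.1, ht.2.lt_of_ne ht1⟩).sub_const (g t)).pow 2
  obtain ⟨n, hn⟩ := (herror.eventually (gt_mem_nhds hlt)).exists
  exact ⟨a n, b n, c n, (hpos n).1, (hpos n).2.1, (hpos n).2.2, hn⟩

theorem exp_neg_le_inv_one_add {x : ℝ} (hx : 0 ≤ x) : Real.exp (-x) ≤ (1 + x)⁻¹ := by
  rw [Real.exp_neg]
  exact inv_anti₀ (by linarith) (by linarith [Real.add_one_le_exp x])

theorem half_min_le_one_sub_rpow {b x : ℝ} (hb : 0 ≤ b) (hx : 0 ≤ x) (hx1 : x ≤ 1) :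
    1 / 2 * min 1 (b * x) ≤ 1 - (1 - x) ^ b := by
  have hbx : 0 ≤ b * x := mul_nonneg hb hx
  have hpow : (1 - x) ^ b ≤ (1 + b * x)⁻¹ := calc
    (1 - x) ^ b ≤ Real.exp (-x) ^ b :=
      Real.rpow_le_rpow (by linarith) (Real.one_sub_le_exp_neg x) hb
    _ = Real.exp (-(b * x)) := by rw [← Real.exp_mul]; ring_nf
    _ ≤ (1 + b * x)⁻¹ := exp_neg_le_inv_one_add hbx
  have hfrac : 1 / 2 * min 1 (b * x) ≤ 1 - (1 + b * x)⁻¹ := by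
    rw [le_sub_iff_add_le, ← le_sub_iff_add_le', inv_le_iff_one_le_mul₀ (by linarith)]
    rcases le_total 1 (b * x) with h | h
    · rw [min_eq_left h]; linarith
    · rw [min_eq_right h]; nlinarith
  linarith

theorem one_sub_rpow_le_two_mul_min {b x : ℝ} (hb : 0 ≤ b) (hx : 0 ≤ x) (hx1 : x ≤ 1 / 2) :
    1 - (1 - x) ^ b ≤ 2 * min 1 (b * x) := by
  have hexp : Real.exp (-(2 * x)) ≤ 1 - x := by
    refine (exp_neg_le_inv_one_add (by linarith)).trans ?_
    rw [inv_le_iff_one_le_mul₀ (by linarith)]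
    nlinarith
  have hpow : Real.exp (-(2 * (b * x))) ≤ (1 - x) ^ b := calc
    Real.exp (-(2 * (b * x))) = Real.exp (-(2 * x)) ^ b := by rw [← Real.exp_mul]; ring_nf
    _ ≤ (1 - x) ^ b := Real.rpow_le_rpow (Real.exp_pos _).le hexp hb
  rcases le_total 1 (b * x) with h | h
  · rw [min_eq_left h]; linarith [Real.rpow_nonneg (by linarith : 0 ≤ 1 - x) b]
  · rw [min_eq_right h]; linarith [Real.one_sub_le_exp_neg (2 * (b * x))]

/-- The factors `1 / 2` and `2` of the two bounds on `1 - (1 - x) ^ b` are erased by the power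
`c n → 0`. -/
theorem tendsto_kumaraswamy_of_tendsto_min_rpow {a b c : ℕ → ℝ} (hb : ∀ n, 0 ≤ b n)
    (hc : ∀ n, 0 ≤ c n) (ha_lim : Tendsto a atTop atTop) (hc_lim : Tendsto c atTop (𝓝 0))
    {t l : ℝ} (ht : t ∈ Ioo (0 : ℝ) 1)
    (h : Tendsto (fun n => min 1 (b n * t ^ a n) ^ c n) atTop (𝓝 l)) :
    Tendsto (fun n => kumaraswamy (a n) (b n) (c n) t) atTop (𝓝 l) := by
  have hx (n : ℕ) : 0 ≤ t ^ a n := Real.rpow_nonneg ht.1.le _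
  have hmin (n : ℕ) : 0 ≤ min 1 (b n * t ^ a n) := le_min zero_le_one (mul_nonneg (hb n) (hx n))
  have hsmall : ∀ᶠ n in atTop, t ^ a n ≤ 1 / 2 :=
    ((tendsto_rpow_atTop_of_base_lt_one t (by linarith [ht.1]) ht.2).comp ha_lim).eventually
      (ge_mem_nhds (by norm_num))
  have hfactor {K : ℝ} (hK : 0 < K) :
      Tendsto (fun n => (K * min 1 (b n * t ^ a n)) ^ c n) atTop (𝓝 l) := by
    have hpow : Tendsto (fun n => K ^ c n) atTop (𝓝 1) := by
      simpa [Function.comp_def] using (Real.continuousAt_const_rpow hK.ne').tendsto.comp hc_lim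
    simpa [Real.mul_rpow hK.le (hmin _)] using hpow.mul h
  refine tendsto_of_tendsto_of_tendsto_of_le_of_le' (hfactor one_half_pos) (hfactor two_pos) ?_ ?_
  all_goals
    filter_upwards [hsmall] with n hn
    have hlower := half_min_le_one_sub_rpow (hb n) (hx n) (by linarith)
  · exact Real.rpow_le_rpow (by linarith [hmin n]) hlower (hc n)
  · exact Real.rpow_le_rpow (by linarith [hmin n]) (one_sub_rpow_le_two_mul_min (hb n) (hx n) hn)
      (hc n)

theorem min_one_mul_rpow_rpow {A a c t : ℝ} (hA : 0 ≤ A) (hc : 0 < c) (ht : 0 ≤ t) :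
    min 1 (A ^ c⁻¹ * t ^ a) ^ c = min 1 (A * t ^ (a * c)) := by
  have hAc : 0 ≤ A ^ c⁻¹ := Real.rpow_nonneg hA _
  have hta : 0 ≤ t ^ a := Real.rpow_nonneg ht _
  rw [(Real.monotoneOn_rpow_Ici_of_exponent_nonneg hc.le).map_min (by simp) (mul_nonneg hAc hta),
    Real.one_rpow, Real.mul_rpow hAc hta, Real.rpow_inv_rpow hA hc.ne', Real.rpow_mul ht]

theorem isKumaraswamyLimit_of_tendsto_min_one_mul_rpow {F : ℝ → ℝ} {A k : ℕ → ℝ}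
    (hA : ∀ n, 0 < A n) (hk : ∀ n, 0 < k n)
    (hF : ∀ᵐ t, t ∈ Ioo (0 : ℝ) 1 →
      Tendsto (fun n => min 1 (A n * t ^ k n)) atTop (𝓝 (F t))) :
    IsKumaraswamyLimit F := by
  set a : ℕ → ℝ := fun n => (n + 1) * (k n + 1)
  set c : ℕ → ℝ := fun n => k n / a n with hc
  have ha_ge (n : ℕ) : (n : ℝ) + 1 ≤ a n := by nlinarith [hk n]
  have ha_pos (n : ℕ) : 0 < a n := by have := hk n; positivity
  have hc_pos (n : ℕ) : 0 < c n := div_pos (hk n) (ha_pos n)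
  have ha_lim : Tendsto a atTop atTop := tendsto_atTop_mono ha_ge
    (tendsto_atTop_add_const_right _ _ tendsto_natCast_atTop_atTop)
  have hc_le (n : ℕ) : c n ≤ 1 / ((n : ℝ) + 1) := by
    rw [hc, div_le_div_iff₀ (ha_pos n) (by positivity)]
    nlinarith [hk n]
  have hc_lim : Tendsto c atTop (𝓝 0) :=
    squeeze_zero (fun n => (hc_pos n).le) hc_le tendsto_one_div_add_atTop_nhds_zero_nat
  refine ⟨a, fun n => A n ^ (c n)⁻¹, c,
    fun n => ⟨ha_pos n, Real.rpow_pos_of_pos (hA n) _, hc_pos n⟩, ?_⟩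
  filter_upwards [hF] with t hlim ht
  refine tendsto_kumaraswamy_of_tendsto_min_rpow (fun n => Real.rpow_nonneg (hA n).le _)
    (fun n => (hc_pos n).le) ha_lim hc_lim ht ((hlim ht).congr fun n => ?_)
  rw [min_one_mul_rpow_rpow (hA n).le (hc_pos n) ht.1.le, mul_div_cancel₀ _ (ha_pos n).ne']

theorem isKumaraswamyLimit_min_one_mul_rpow {A k : ℝ} (hA : 0 < A) (hk : 0 ≤ k) :
    IsKumaraswamyLimit fun t => min 1 (A * t ^ k) := by
  refine isKumaraswamyLimit_of_tendsto_min_one_mul_rpow (A := fun _ => A)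
    (k := fun n => k + 1 / (n + 1)) (fun _ => hA) (fun n => by positivity)
    (.of_forall fun t ht => tendsto_const_nhds.min (.const_mul A ?_))
  refine (Real.continuousAt_const_rpow ht.1.ne').tendsto.comp ?_
  simpa using tendsto_one_div_add_atTop_nhds_zero_nat.const_add k

theorem isKumaraswamyLimit_step {s : ℝ} (hs : 0 < s) :
    IsKumaraswamyLimit fun t => if t ≤ s then 0 else 1 := by
  have hlin : Tendsto (fun n : ℕ => (n : ℝ) + 1) atTop atTop :=
    tendsto_atTop_add_const_right _ _ tendsto_natCast_atTop_atTop
  refine isKumaraswamyLimit_of_tendsto_min_one_mul_rpow (A := fun n => s⁻¹ ^ ((n : ℝ) + 1))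
    (k := fun n => n + 1) (fun n => by positivity) (fun n => by positivity) ?_
  filter_upwards [Measure.ae_ne volume s] with t hts ht
  have hratio : 0 < s⁻¹ * t := mul_pos (inv_pos.2 hs) ht.1
  simp only [← Real.mul_rpow (inv_pos.2 hs).le ht.1.le]
  rcases hts.lt_or_gt with h | h
  · have hlt : s⁻¹ * t < 1 := by rwa [inv_mul_lt_iff₀ hs, mul_one]
    have hpow := (tendsto_rpow_atTop_of_base_lt_one _ (by linarith) hlt).comp hlin
    simpa [h.le] using (tendsto_const_nhds (x := (1 : ℝ))).min hpow
  · have hge : 1 ≤ s⁻¹ * t := by rw [le_inv_mul_iff₀ hs]; linarith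
    rw [if_neg h.not_ge]
    refine tendsto_const_nhds.congr fun n => ?_
    rw [min_eq_left (Real.one_le_rpow hge (by positivity))]

theorem exists_kumaraswamyError_lt_of_mul_rpow {g : ℝ → ℝ} (hg : g ∈ monotoneClass) {A k ε : ℝ}
    (hA : 0 < A) (hk : 0 ≤ k) (hlt : ∫ t in (0 : ℝ)..1, (A * t ^ k - g t) ^ 2 < ε) :
    ∃ a b c : ℝ, 0 < a ∧ 0 < b ∧ 0 < c ∧ kumaraswamyError g a b c < ε := by
  refine (isKumaraswamyLimit_min_one_mul_rpow hA hk).exists_kumaraswamyError_lt hg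
    (lt_of_le_of_lt ?_ hlt)
  have hpow : Continuous fun t : ℝ => A * t ^ k := (Real.continuous_rpow_const hk).const_mul A
  refine intervalIntegral.integral_mono_on zero_le_one
    (((continuous_const.min hpow).continuousOn.sub hg.1).pow 2 |>.intervalIntegrable_of_Icc
      zero_le_one)
    ((hpow.continuousOn.sub hg.1).pow 2 |>.intervalIntegrable_of_Icc zero_le_one) fun t ht => ?_
  have hgt := (monotoneClass_apply_mem_Icc hg ht).2
  rcases le_total 1 (A * t ^ k) with h | h
  · rw [min_eq_left h]
    gcongr
  · rw [min_eq_right h]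

/-- Sum the hypothesis over finer and finer uniform partitions of `[a, b]`: the right-hand sides
telescope to `(b - a) / (n + 1) * (G b - G a)`. -/
theorem le_of_forall_sub_le_mul_sub {D G : ℝ → ℝ} {a b : ℝ} (hab : a ≤ b)
    (h : ∀ x ∈ Icc a b, ∀ z ∈ Icc a b, x ≤ z → D z - D x ≤ (z - x) * (G z - G x)) :
    D b ≤ D a := by
  have hpartition (n : ℕ) : D b - D a ≤ (b - a) * (G b - G a) * (1 / ((n : ℝ) + 1)) := by
    set δ : ℝ := (b - a) / (n + 1) with hδ
    set x : ℕ → ℝ := fun i => a + i * δ with hx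
    have hδ_nonneg : 0 ≤ δ := div_nonneg (sub_nonneg.2 hab) (by positivity)
    have hx_zero : x 0 = a := by simp [hx]
    have hx_last : x (n + 1) = b := by
      simp only [hx, hδ]
      push_cast
      field_simp
      ring
    have hx_mono : Monotone x := fun i j hij => by
      simp only [hx]
      gcongr
    have hx_mem (i : ℕ) (hi : i ≤ n + 1) : x i ∈ Icc a b :=
      ⟨hx_zero ▸ hx_mono i.zero_le, hx_last ▸ hx_mono hi⟩
    have hx_step (i : ℕ) : x (i + 1) - x i = δ := by
      simp only [hx]
      push_cast
      ring
    calc D b - D a = ∑ i ∈ Finset.range (n + 1), (D (x (i + 1)) - D (x i)) := by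
          rw [Finset.sum_range_sub fun i => D (x i), hx_last, hx_zero]
      _ ≤ ∑ i ∈ Finset.range (n + 1), δ * (G (x (i + 1)) - G (x i)) := by
          refine Finset.sum_le_sum fun i hi => ?_
          rw [Finset.mem_range] at hi
          simpa only [hx_step] using h _ (hx_mem i (by lia)) _ (hx_mem (i + 1) (by lia))
            (hx_mono i.le_succ)
      _ = (b - a) * (G b - G a) * (1 / ((n : ℝ) + 1)) := by
          rw [← Finset.mul_sum, Finset.sum_range_sub fun i => G (x i), hx_last, hx_zero, hδ]
          ring
  have hlim : Tendsto (fun n : ℕ => (b - a) * (G b - G a) * (1 / ((n : ℝ) + 1))) atTop (𝓝 0) := by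
    simpa using tendsto_one_div_add_atTop_nhds_zero_nat.const_mul ((b - a) * (G b - G a))
  linarith [ge_of_tendsto' hlim hpartition]

/-- A second mean value inequality. With `Φ t = ∫ x in a..t, φ x`, integration by parts would give
`∫ φ g = Φ b * g b - ∫ Φ dg`; for want of a derivative of `g`, the increments of
`∫ x in a..t, φ x * g x - Φ t * g t` are estimated instead. -/
theorem integral_mul_le_of_primitive_nonneg {a b : ℝ} (hab : a ≤ b) {φ g : ℝ → ℝ}
    (hφ : ContinuousOn φ (Icc a b)) (hg : MonotoneOn g (Icc a b))
    (hprimitive : ∀ t ∈ Icc a b, 0 ≤ ∫ x in a..t, φ x) :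
    ∫ x in a..b, φ x * g x ≤ (∫ x in a..b, φ x) * g b := by
  obtain ⟨C, hC⟩ := isCompact_Icc.exists_bound_of_continuousOn hφ
  have hφ_int {x z : ℝ} (hx : x ∈ Icc a b) (hz : z ∈ Icc a b) :
      IntervalIntegrable φ volume x z :=
    (hφ.mono (ordConnected_Icc.uIcc_subset hx hz)).intervalIntegrable
  have hφg_int {x z : ℝ} (hx : x ∈ Icc a b) (hz : z ∈ Icc a b) :
      IntervalIntegrable (fun t => φ t * g t) volume x z :=
    (hg.mono (ordConnected_Icc.uIcc_subset hx hz)).intervalIntegrable.continuousOn_mul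
      (hφ.mono (ordConnected_Icc.uIcc_subset hx hz))
  have ha : a ∈ Icc a b := left_mem_Icc.2 hab
  have key := le_of_forall_sub_le_mul_sub
    (D := fun t => (∫ x in a..t, φ x * g x) - (∫ x in a..t, φ x) * g t) (G := fun t => C * g t)
    hab fun x hx z hz hxz => ?_
  · simpa using key
  have hlocal : (∫ y in x..z, φ y * g y) - (∫ y in x..z, φ y) * g z
      ≤ (z - x) * (C * g z - C * g x) := by
    have hφgz_int := (hφ_int hx hz).mul_const (g z)
    rw [← intervalIntegral.integral_mul_const,
      ← intervalIntegral.integral_sub (hφg_int hx hz) hφgz_int, ← smul_eq_mul (z - x),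
      ← intervalIntegral.integral_const]
    refine intervalIntegral.integral_mono_on hxz ((hφg_int hx hz).sub hφgz_int) (by simp)
      fun y hy => ?_
    have hy_mem : y ∈ Icc a b := ⟨hx.1.trans hy.1, hy.2.trans hz.2⟩
    have hyC := abs_le.1 (hC y hy_mem)
    have hC_nonneg : 0 ≤ C := by linarith
    nlinarith [mul_nonneg (neg_le_iff_add_nonneg.1 hyC.1) (sub_nonneg.2 (hg hy_mem hz hy.2)),
      mul_nonneg hC_nonneg (sub_nonneg.2 (hg hx hy_mem hy.1))]
  have hincrement : 0 ≤ (∫ y in a..x, φ y) * (g z - g x) :=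
    mul_nonneg (hprimitive x hx) (sub_nonneg.2 (hg hx hz hxz))
  rw [← intervalIntegral.integral_add_adjacent_intervals (hφg_int ha hx) (hφg_int hx hz),
    ← intervalIntegral.integral_add_adjacent_intervals (hφ_int ha hx) (hφ_int hx hz)]
  linarith

theorem integral_linear_combination {a b : ℝ} {f g k : ℝ → ℝ}
    (hf : IntervalIntegrable f volume a b) (hg : IntervalIntegrable g volume a b)
    (hk : IntervalIntegrable k volume a b) (α β γ : ℝ) :
    ∫ t in a..b, (α * f t + β * g t + γ * k t)
      = α * (∫ t in a..b, f t) + β * (∫ t in a..b, g t) + γ * ∫ t in a..b, k t := by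
  rw [intervalIntegral.integral_add ((hf.const_mul α).add (hg.const_mul β)) (hk.const_mul γ),
    intervalIntegral.integral_add (hf.const_mul α) (hg.const_mul β),
    intervalIntegral.integral_const_mul, intervalIntegral.integral_const_mul,
    intervalIntegral.integral_const_mul]

/-- The mean of a distribution supported in `[a, b]` with distribution function `F`, by partial
integration of `∫ t dF`. -/
noncomputable def cdfMean (F : ℝ → ℝ) (a b : ℝ) : ℝ :=
  b - ∫ t in a..b, F t

/-- Half the Gini mean difference `E |X - Y|` of two independent variables supported in `[a, b]`
with distribution function `F`. -/
noncomputable def cdfGini (F : ℝ → ℝ) (a b : ℝ) : ℝ :=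
  ∫ t in a..b, F t * (1 - F t)

section Cdf

variable {F : ℝ → ℝ} {a b : ℝ}

theorem cdfMean_mem_Icc (hab : a ≤ b) (hF : ContinuousOn F (Icc a b))
    (hF01 : ∀ t ∈ Icc a b, F t ∈ Icc (0 : ℝ) 1) : cdfMean F a b ∈ Icc a b := by
  have hlower := intervalIntegral.integral_nonneg (μ := volume) hab fun t ht => (hF01 t ht).1
  have hupper := intervalIntegral.integral_mono_on (μ := volume) hab
    (hF.intervalIntegrable_of_Icc hab) (g := fun _ => 1) (by simp) fun t ht => (hF01 t ht).2
  rw [intervalIntegral.integral_const, smul_eq_mul, mul_one] at hupper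
  exact ⟨by unfold cdfMean; linarith, by unfold cdfMean; linarith⟩

theorem cdfGini_nonneg (hab : a ≤ b) (hF01 : ∀ t ∈ Icc a b, F t ∈ Icc (0 : ℝ) 1) :
    0 ≤ cdfGini F a b :=
  intervalIntegral.integral_nonneg hab fun t ht =>
    mul_nonneg (hF01 t ht).1 (sub_nonneg.2 (hF01 t ht).2)

theorem cdfGini_eq (hab : a ≤ b) (hF : ContinuousOn F (Icc a b)) :
    cdfGini F a b = (∫ t in a..b, F t) - ∫ t in a..b, F t ^ 2 := by
  rw [← intervalIntegral.integral_sub (hF.intervalIntegrable_of_Icc hab)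
    (ContinuousOn.intervalIntegrable_of_Icc hab (by fun_prop))]
  unfold cdfGini
  congr! 2
  ring

/-- The left-hand side is the second moment `∫ t ^ 2 dF`, so this bounds the variance. -/
theorem sq_sub_two_mul_integral_id_mul_le (hab : a ≤ b) (hF : ContinuousOn F (Icc a b))
    (hF_mono : MonotoneOn F (Icc a b)) (hF01 : ∀ t ∈ Icc a b, F t ∈ Icc (0 : ℝ) 1) :
    b ^ 2 - 2 * (∫ t in a..b, t * F t) ≤ cdfMean F a b ^ 2 + (b - a) * cdfGini F a b := by
  set I := ∫ t in a..b, F t with hI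
  have hint {f : ℝ → ℝ} (hf : ContinuousOn f (Icc a b)) {x z : ℝ} (hx : x ∈ Icc a b)
      (hz : z ∈ Icc a b) : IntervalIntegrable f volume x z :=
    (hf.mono (ordConnected_Icc.uIcc_subset hx hz)).intervalIntegrable
  have ha : a ∈ Icc a b := left_mem_Icc.2 hab
  have hb : b ∈ Icc a b := right_mem_Icc.2 hab
  have hprimitive {t : ℝ} (ht : t ∈ Icc a b) :
      ∫ x in a..t, ((a + b - I) * 1 + (-2) * x + (b - a) * F x)
        = (b - t) * (∫ x in a..t, F x) + (t - a) * ((b - t) - ∫ x in t..b, F x) := by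
    have hsplit : (∫ x in a..t, F x) + ∫ x in t..b, F x = I :=
      intervalIntegral.integral_add_adjacent_intervals (hint hF ha ht) (hint hF ht hb)
    rw [integral_linear_combination (f := fun _ => 1) (g := fun x => x) (by simp) (by simp)
      (hint hF ha ht), integral_id, intervalIntegral.integral_const, smul_eq_mul, ← hsplit]
    ring
  have key := integral_mul_le_of_primitive_nonneg hab
    (φ := fun x => (a + b - I) * 1 + (-2) * x + (b - a) * F x) (by fun_prop) hF_mono
    fun t ht => ?_
  · have hexpand : ∫ x in a..b, ((a + b - I) * 1 + (-2) * x + (b - a) * F x) * F x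
        = (a + b - I) * I + (-2) * (∫ x in a..b, x * F x) + (b - a) * ∫ x in a..b, F x ^ 2 := by
      rw [hI, ← integral_linear_combination (hint hF ha hb)
        (hint (f := fun x => x * F x) (by fun_prop) ha hb)
        (hint (f := fun x => F x ^ 2) (by fun_prop) ha hb)]
      congr! 2
      ring
    rw [hprimitive hb, hexpand] at key
    rw [cdfGini_eq hab hF, cdfMean, ← hI]
    simp only [intervalIntegral.integral_same, sub_self] at key
    linarith
  · have hleft : 0 ≤ ∫ x in a..t, F x := intervalIntegral.integral_nonneg ht.1
      fun x hx => (hF01 x ⟨hx.1, hx.2.trans ht.2⟩).1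
    have hright := (cdfMean_mem_Icc ht.2 (hF.mono (Icc_subset_Icc_left ht.1))
      fun x hx => hF01 x ⟨ht.1.trans hx.1, hx.2⟩).1
    rw [cdfMean] at hright
    rw [hprimitive ht]
    exact add_nonneg (mul_nonneg (by linarith [ht.2]) hleft)
      (mul_nonneg (by linarith [ht.1]) (by linarith))

end Cdf

/-- The mean of the lower half, of distribution function `2 * g` on `[0, s]`, of a distribution
on `[0, 1]` with distribution function `g` and median `s`. -/
noncomputable def lowerHalfMean (g : ℝ → ℝ) (s : ℝ) : ℝ :=
  cdfMean (fun t => 2 * g t) 0 s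

/-- The mean of the upper half, of distribution function `2 * g - 1` on `[s, 1]`, of a
distribution on `[0, 1]` with distribution function `g` and median `s`. -/
noncomputable def upperHalfMean (g : ℝ → ℝ) (s : ℝ) : ℝ :=
  cdfMean (fun t => 2 * g t - 1) s 1

/-- The total dispersion, measured by `cdfGini`, within the lower and upper halves of a
distribution on `[0, 1]` with distribution function `g` and median `s`. -/
noncomputable def halvesGini (g : ℝ → ℝ) (s : ℝ) : ℝ :=
  cdfGini (fun t => 2 * g t) 0 s + cdfGini (fun t => 2 * g t - 1) s 1

/-- An upper bound for the sum of the second moments of the two halves with means `u` and `v` and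
total dispersion `h`. The maximum bounds the lengths of the supports `[0, s]` and `[s, 1]`, as the
median `s` lies between `u` and `v`. -/
def secondMomentBound (u v h : ℝ) : ℝ :=
  u ^ 2 + v ^ 2 + max v (1 - u) * h

section Halves

variable {g : ℝ → ℝ} {s : ℝ}

theorem intervalIntegrable_lower (hs : s ∈ Icc (0 : ℝ) 1) {f : ℝ → ℝ}
    (hf : ContinuousOn f (Icc 0 1)) : IntervalIntegrable f volume 0 s :=
  (hf.mono (Icc_subset_Icc_right hs.2)).intervalIntegrable_of_Icc hs.1

theorem intervalIntegrable_upper (hs : s ∈ Icc (0 : ℝ) 1) {f : ℝ → ℝ}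
    (hf : ContinuousOn f (Icc 0 1)) : IntervalIntegrable f volume s 1 :=
  (hf.mono (Icc_subset_Icc_left hs.1)).intervalIntegrable_of_Icc hs.2

theorem integral_lower_add_upper (hs : s ∈ Icc (0 : ℝ) 1) {f : ℝ → ℝ}
    (hf : ContinuousOn f (Icc 0 1)) :
    (∫ t in (0 : ℝ)..s, f t) + ∫ t in s..1, f t = ∫ t in (0 : ℝ)..1, f t :=
  intervalIntegral.integral_add_adjacent_intervals (intervalIntegrable_lower hs hf)
    (intervalIntegrable_upper hs hf)

theorem lowerHalfMean_eq (g : ℝ → ℝ) (s : ℝ) :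
    lowerHalfMean g s = s - 2 * ∫ t in (0 : ℝ)..s, g t := by
  rw [lowerHalfMean, cdfMean, intervalIntegral.integral_const_mul]

theorem upperHalfMean_eq (hg : ContinuousOn g (Icc 0 1)) (hs : s ∈ Icc (0 : ℝ) 1) :
    upperHalfMean g s = 2 - s - 2 * ∫ t in s..1, g t := by
  rw [upperHalfMean, cdfMean, intervalIntegral.integral_sub
    ((intervalIntegrable_upper hs hg).const_mul 2) (by simp), intervalIntegral.integral_const_mul,
    intervalIntegral.integral_const, smul_eq_mul]
  ring

theorem halvesGini_eq (hg : ContinuousOn g (Icc 0 1)) (hs : s ∈ Icc (0 : ℝ) 1) :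
    halvesGini g s = 2 * (∫ t in (0 : ℝ)..s, g t) + 6 * (∫ t in s..1, g t)
      - 4 * (∫ t in (0 : ℝ)..1, g t ^ 2) - 2 * (1 - s) := by
  have hg_sq : ContinuousOn (fun t => g t ^ 2) (Icc 0 1) := hg.pow 2
  have hlower : cdfGini (fun t => 2 * g t) 0 s
      = 2 * (∫ t in (0 : ℝ)..s, g t) - 4 * ∫ t in (0 : ℝ)..s, g t ^ 2 := by
    rw [← intervalIntegral.integral_const_mul, ← intervalIntegral.integral_const_mul,
      ← intervalIntegral.integral_sub ((intervalIntegrable_lower hs hg).const_mul 2)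
        ((intervalIntegrable_lower hs hg_sq).const_mul 4), cdfGini]
    congr! 2
    ring
  have hupper : cdfGini (fun t => 2 * g t - 1) s 1
      = 6 * (∫ t in s..1, g t) + (-4) * (∫ t in s..1, g t ^ 2) + (-2) * ∫ _ in s..1, (1 : ℝ) := by
    rw [← integral_linear_combination (intervalIntegrable_upper hs hg)
      (intervalIntegrable_upper hs hg_sq) (by simp), cdfGini]
    congr! 2
    ring
  rw [halvesGini, hlower, hupper, ← integral_lower_add_upper hs hg_sq,
    intervalIntegral.integral_const, smul_eq_mul]
  ring

theorem integral_eq_halfMeans (hg : ContinuousOn g (Icc 0 1)) (hs : s ∈ Icc (0 : ℝ) 1) :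
    ∫ t in (0 : ℝ)..1, g t = 1 - (lowerHalfMean g s + upperHalfMean g s) / 2 := by
  rw [lowerHalfMean_eq, upperHalfMean_eq hg hs, ← integral_lower_add_upper hs hg]
  ring

theorem integral_sq_eq_halves (hg : ContinuousOn g (Icc 0 1)) (hs : s ∈ Icc (0 : ℝ) 1) :
    ∫ t in (0 : ℝ)..1, g t ^ 2 = 1 - upperHalfMean g s
      + (upperHalfMean g s - lowerHalfMean g s - halvesGini g s) / 4 := by
  rw [lowerHalfMean_eq, upperHalfMean_eq hg hs, halvesGini_eq hg hs]
  ring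

theorem integral_step_sub_sq (hg : ContinuousOn g (Icc 0 1)) (hs : s ∈ Icc (0 : ℝ) 1) :
    ∫ t in (0 : ℝ)..1, ((if t ≤ s then 0 else 1) - g t) ^ 2
      = (upperHalfMean g s - lowerHalfMean g s - halvesGini g s) / 4 := by
  have hg_sq : ContinuousOn (fun t => g t ^ 2) (Icc 0 1) := hg.pow 2
  have hlower : EqOn (fun t => g t ^ 2) (fun t => ((if t ≤ s then 0 else 1) - g t) ^ 2)
      (uIoc 0 s) := fun t ht => by
    rw [uIoc_of_le hs.1] at ht
    simp [ht.2]
  have hupper : EqOn (fun t => 1 * 1 + (-2) * g t + 1 * g t ^ 2)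
      (fun t => ((if t ≤ s then 0 else 1) - g t) ^ 2) (uIoc s 1) := fun t ht => by
    rw [uIoc_of_le hs.2] at ht
    simp only [if_neg (not_le.2 ht.1)]
    ring
  rw [← intervalIntegral.integral_add_adjacent_intervals
      ((intervalIntegrable_lower hs hg_sq).congr hlower)
      ((intervalIntegrable_upper hs (by fun_prop)).congr hupper),
    ← intervalIntegral.integral_congr_ae (.of_forall fun _ ht => hlower ht),
    ← intervalIntegral.integral_congr_ae (.of_forall fun _ ht => hupper ht),
    integral_linear_combination (f := fun _ => 1) (by simp) (intervalIntegrable_upper hs hg)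
      (intervalIntegrable_upper hs hg_sq), intervalIntegral.integral_const, smul_eq_mul,
    lowerHalfMean_eq, upperHalfMean_eq hg hs, halvesGini_eq hg hs,
    ← integral_lower_add_upper hs hg_sq]
  ring

theorem two_mul_mem_Icc_of_le_median (hg : g ∈ monotoneClass) (hs : s ∈ Icc (0 : ℝ) 1)
    (hgs : g s = 1 / 2) {t : ℝ} (ht : t ∈ Icc 0 s) : 2 * g t ∈ Icc (0 : ℝ) 1 := by
  have ht_mem : t ∈ Icc (0 : ℝ) 1 := ⟨ht.1, ht.2.trans hs.2⟩
  exact ⟨by linarith [(monotoneClass_apply_mem_Icc hg ht_mem).1],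
    by linarith [hg.2.1 ht_mem hs ht.2]⟩

theorem two_mul_sub_one_mem_Icc_of_median_le (hg : g ∈ monotoneClass) (hs : s ∈ Icc (0 : ℝ) 1)
    (hgs : g s = 1 / 2) {t : ℝ} (ht : t ∈ Icc s 1) : 2 * g t - 1 ∈ Icc (0 : ℝ) 1 := by
  have ht_mem : t ∈ Icc (0 : ℝ) 1 := ⟨hs.1.trans ht.1, ht.2⟩
  exact ⟨by linarith [hg.2.1 hs ht_mem ht.1],
    by linarith [(monotoneClass_apply_mem_Icc hg ht_mem).2]⟩

theorem lowerHalfMean_mem_Icc (hg : g ∈ monotoneClass) (hs : s ∈ Icc (0 : ℝ) 1)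
    (hgs : g s = 1 / 2) : lowerHalfMean g s ∈ Icc 0 s :=
  cdfMean_mem_Icc hs.1 ((hg.1.const_mul 2).mono (Icc_subset_Icc_right hs.2))
    fun _ => two_mul_mem_Icc_of_le_median hg hs hgs

theorem upperHalfMean_mem_Icc (hg : g ∈ monotoneClass) (hs : s ∈ Icc (0 : ℝ) 1)
    (hgs : g s = 1 / 2) : upperHalfMean g s ∈ Icc s 1 :=
  cdfMean_mem_Icc hs.2
    (((hg.1.const_mul 2).sub continuousOn_const).mono (Icc_subset_Icc_left hs.1))
    fun _ => two_mul_sub_one_mem_Icc_of_median_le hg hs hgs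

theorem halvesGini_nonneg (hg : g ∈ monotoneClass) (hs : s ∈ Icc (0 : ℝ) 1)
    (hgs : g s = 1 / 2) : 0 ≤ halvesGini g s :=
  add_nonneg (cdfGini_nonneg hs.1 fun _ => two_mul_mem_Icc_of_le_median hg hs hgs)
    (cdfGini_nonneg hs.2 fun _ => two_mul_sub_one_mem_Icc_of_median_le hg hs hgs)

theorem lowerHalf_secondMoment_le (hg : g ∈ monotoneClass) (hs : s ∈ Icc (0 : ℝ) 1)
    (hgs : g s = 1 / 2) :
    s ^ 2 - 4 * (∫ t in (0 : ℝ)..s, t * g t)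
      ≤ lowerHalfMean g s ^ 2 + s * cdfGini (fun t => 2 * g t) 0 s := by
  have hsub : Icc 0 s ⊆ Icc (0 : ℝ) 1 := Icc_subset_Icc_right hs.2
  have hmono : MonotoneOn (fun t => 2 * g t) (Icc 0 s) := fun x hx y hy hxy =>
    mul_le_mul_of_nonneg_left (hg.2.1 (hsub hx) (hsub hy) hxy) zero_le_two
  have hmoment := sq_sub_two_mul_integral_id_mul_le hs.1 ((hg.1.const_mul 2).mono hsub) hmono
    fun _ => two_mul_mem_Icc_of_le_median hg hs hgs
  have hintegral : ∫ t in (0 : ℝ)..s, t * (2 * g t) = 2 * ∫ t in (0 : ℝ)..s, t * g t := by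
    rw [← intervalIntegral.integral_const_mul]
    congr! 2
    ring
  rw [hintegral, ← lowerHalfMean] at hmoment
  linarith

theorem upperHalf_secondMoment_le (hg : g ∈ monotoneClass) (hs : s ∈ Icc (0 : ℝ) 1)
    (hgs : g s = 1 / 2) :
    2 - s ^ 2 - 4 * (∫ t in s..1, t * g t)
      ≤ upperHalfMean g s ^ 2 + (1 - s) * cdfGini (fun t => 2 * g t - 1) s 1 := by
  have hsub : Icc s 1 ⊆ Icc (0 : ℝ) 1 := Icc_subset_Icc_left hs.1
  have hcont : ContinuousOn (fun t => 2 * g t - 1) (Icc s 1) :=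
    ((hg.1.const_mul 2).mono hsub).sub continuousOn_const
  have hmono : MonotoneOn (fun t => 2 * g t - 1) (Icc s 1) := fun x hx y hy hxy => by
    linarith [hg.2.1 (hsub hx) (hsub hy) hxy]
  have hmoment := sq_sub_two_mul_integral_id_mul_le hs.2 hcont hmono
    fun _ => two_mul_sub_one_mem_Icc_of_median_le hg hs hgs
  have htg_cont : ContinuousOn (fun t => t * g t) (Icc 0 1) := continuousOn_id.mul hg.1
  have hintegral : ∫ t in s..1, t * (2 * g t - 1)
      = 2 * (∫ t in s..1, t * g t) - ∫ t in s..1, t := by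
    rw [← intervalIntegral.integral_const_mul, ← intervalIntegral.integral_sub
      ((intervalIntegrable_upper hs htg_cont).const_mul 2) (by simp)]
    congr! 2
    ring
  rw [hintegral, integral_id, ← upperHalfMean] at hmoment
  linarith

theorem two_sub_secondMomentBound_le (hg : g ∈ monotoneClass) (hs : s ∈ Icc (0 : ℝ) 1)
    (hgs : g s = 1 / 2) :
    2 - secondMomentBound (lowerHalfMean g s) (upperHalfMean g s) (halvesGini g s)
      ≤ 4 * ∫ t in (0 : ℝ)..1, t * g t := by
  have hs_le : s ≤ max (upperHalfMean g s) (1 - lowerHalfMean g s) :=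
    le_max_of_le_left (upperHalfMean_mem_Icc hg hs hgs).1
  have hs_le' : 1 - s ≤ max (upperHalfMean g s) (1 - lowerHalfMean g s) :=
    le_max_of_le_right (sub_le_sub_left (lowerHalfMean_mem_Icc hg hs hgs).2 1)
  have hlower := mul_le_mul_of_nonneg_right hs_le
    (cdfGini_nonneg hs.1 fun _ => two_mul_mem_Icc_of_le_median hg hs hgs)
  have hupper := mul_le_mul_of_nonneg_right hs_le'
    (cdfGini_nonneg hs.2 fun _ => two_mul_sub_one_mem_Icc_of_median_le hg hs hgs)
  rw [← integral_lower_add_upper hs (f := fun t => t * g t) (continuousOn_id.mul hg.1),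
    secondMomentBound, halvesGini, mul_add]
  linarith [lowerHalf_secondMoment_le hg hs hgs, upperHalf_secondMoment_le hg hs hgs]

end Halves

theorem integral_add_sub_sqrt {r : ℝ} (hr : 0 < r) {t : ℝ} (ht : 0 ≤ t) :
    ∫ x in (0 : ℝ)..t, (r / 2 * 1 + r⁻¹ * x + (-3 / 2) * √x) = t * (r - √t) ^ 2 / (2 * r) := by
  have hsqrt : ∫ x in (0 : ℝ)..t, √x = 2 / 3 * (t * √t) := by
    simp_rw [Real.sqrt_eq_rpow]
    rw [integral_rpow (Or.inl (by norm_num)), Real.zero_rpow (by norm_num),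
      Real.rpow_add_one' ht (by norm_num)]
    ring
  rw [integral_linear_combination (f := fun _ => 1) (g := fun x => x) (by simp) (by simp)
    (Real.continuous_sqrt.intervalIntegrable _ _), hsqrt, integral_id,
    intervalIntegral.integral_const, smul_eq_mul]
  field_simp
  linear_combination (-t) * Real.sq_sqrt ht

theorem le_integral_sqrt_mul {g : ℝ → ℝ} (hg : MonotoneOn g (Icc 0 1)) {r : ℝ} (hr : 0 < r) :
    r / 2 * (∫ t in (0 : ℝ)..1, g t) + r⁻¹ * (∫ t in (0 : ℝ)..1, t * g t)
        - (1 - r) ^ 2 / (2 * r) * g 1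
      ≤ 3 / 2 * ∫ t in (0 : ℝ)..1, √t * g t := by
  have hg_int : IntervalIntegrable g volume 0 1 :=
    (hg.mono (uIcc_of_le zero_le_one).subset).intervalIntegrable
  have key := integral_mul_le_of_primitive_nonneg zero_le_one
    (φ := fun x => r / 2 * 1 + r⁻¹ * x + (-3 / 2) * √x) (by fun_prop) hg fun t ht => by
      rw [integral_add_sub_sqrt hr ht.1]
      exact div_nonneg (mul_nonneg ht.1 (sq_nonneg _)) (by linarith)
  have hexpand : ∫ t in (0 : ℝ)..1, (r / 2 * 1 + r⁻¹ * t + (-3 / 2) * √t) * g t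
      = r / 2 * (∫ t in (0 : ℝ)..1, g t) + r⁻¹ * (∫ t in (0 : ℝ)..1, t * g t)
        + (-3 / 2) * ∫ t in (0 : ℝ)..1, √t * g t := by
    rw [← integral_linear_combination hg_int
      (hg_int.continuousOn_mul (g := fun t => t) continuousOn_id)
      (hg_int.continuousOn_mul Real.continuous_sqrt.continuousOn)]
    congr! 2
    ring
  rw [hexpand, integral_add_sub_sqrt hr zero_le_one, Real.sqrt_one, one_mul, ← neg_sub 1 r,
    neg_sq] at key
  linarith

theorem le_integral_sqrt_mul_of_median {g : ℝ → ℝ} (hg : g ∈ monotoneClass) {s : ℝ}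
    (hs : s ∈ Icc (0 : ℝ) 1) (hgs : g s = 1 / 2) {r : ℝ} (hr : 0 < r) :
    2 / 3 * (1 - r / 4 * (lowerHalfMean g s + upperHalfMean g s) - (4 * r)⁻¹ *
        secondMomentBound (lowerHalfMean g s) (upperHalfMean g s) (halvesGini g s))
      ≤ ∫ t in (0 : ℝ)..1, √t * g t := by
  have hsqrt := le_integral_sqrt_mul hg.2.1 hr
  have hmoment := mul_le_mul_of_nonneg_left (two_sub_secondMomentBound_le hg hs hgs)
    (inv_pos.2 hr).le
  have hconst : (1 - r) ^ 2 / (2 * r) = r⁻¹ / 2 - 1 + r / 2 := by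
    field_simp
    ring
  rw [integral_eq_halfMeans hg.1 hs, hg.2.2.2, hconst] at hsqrt
  rw [mul_inv]
  linarith

theorem integral_mul_rpow_sub_sq {g : ℝ → ℝ} (hg : ContinuousOn g (Icc 0 1)) (A : ℝ) {k : ℝ}
    (hk : 0 ≤ k) :
    ∫ t in (0 : ℝ)..1, (A * t ^ k - g t) ^ 2
      = A ^ 2 / (2 * k + 1) - 2 * A * (∫ t in (0 : ℝ)..1, t ^ k * g t)
        + ∫ t in (0 : ℝ)..1, g t ^ 2 := by
  have hint {f : ℝ → ℝ} (hf : ContinuousOn f (Icc 0 1)) : IntervalIntegrable f volume 0 1 :=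
    hf.intervalIntegrable_of_Icc zero_le_one
  have hpow_cont : ContinuousOn (fun t : ℝ => t ^ k) (Icc 0 1) :=
    (Real.continuous_rpow_const hk).continuousOn
  have hpow_sq : ∫ t in (0 : ℝ)..1, (t ^ k) ^ 2 = 1 / (2 * k + 1) := calc
    ∫ t in (0 : ℝ)..1, (t ^ k) ^ 2 = ∫ t in (0 : ℝ)..1, t ^ (2 * k) := by
      refine intervalIntegral.integral_congr fun t ht => ?_
      rw [uIcc_of_le zero_le_one] at ht
      simpa only [mul_comm 2 k, Nat.cast_ofNat] using (Real.rpow_mul_natCast ht.1 k 2).symm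
    _ = 1 / (2 * k + 1) := by
      rw [integral_rpow (Or.inl (by linarith)), Real.one_rpow, Real.zero_rpow (by linarith),
        sub_zero]
  calc ∫ t in (0 : ℝ)..1, (A * t ^ k - g t) ^ 2
      = ∫ t in (0 : ℝ)..1, (A ^ 2 * (t ^ k) ^ 2 + (-2 * A) * (t ^ k * g t) + 1 * g t ^ 2) := by
        congr! 2
        ring
    _ = A ^ 2 / (2 * k + 1) - 2 * A * (∫ t in (0 : ℝ)..1, t ^ k * g t)
        + ∫ t in (0 : ℝ)..1, g t ^ 2 := by
        rw [integral_linear_combination (hint (by fun_prop)) (hint (hpow_cont.fun_mul hg))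
          (hint (hg.fun_pow 2)), hpow_sq]
        ring

section Amplitudes

variable {u v h : ℝ}

/-- The amplitude `(7 - 5 * v) / 4` is an affine substitute for the optimal
`3 / 4 * (2 - secondMomentBound u v h)`. At `h = v - u - 1 / 4` the mean `u` enters only through
`secondMomentBound`, which is convex in `u` on each side of `1 - v`, so the values at the ends of
`[1 / 4, v - 1 / 4]` decide. -/
theorem linearFit_extremal_lt (hu : 1 / 4 ≤ u) (huv : u + 1 / 4 ≤ v) (hv : v ≤ 1) :
    ((7 - 5 * v) / 4) ^ 2 / 3 - (7 - 5 * v) / 4 * (2 - secondMomentBound u v (v - u - 1 / 4)) / 2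
      + (1 - v + 1 / 16) < 1 / 16 := by
  have hA : 0 ≤ 7 - 5 * v := by linarith
  have hchord : 0 ≤ (u - 1 / 4) * (v - 1 / 4 - u) := mul_nonneg (by linarith) (by linarith)
  unfold secondMomentBound
  rcases le_total v (1 - u) with h | h
  · rw [max_eq_right h]
    have hconvex : u ^ 2 + v ^ 2 + (1 - u) * (v - u - 1 / 4) ≤ v ^ 2 + 3 / 4 * v - 5 / 16 := by
      nlinarith
    have hendpoint : 16 - 16 * v + (7 - 5 * v) ^ 2 / 3
        - 2 * (7 - 5 * v) * (2 - (v ^ 2 + 3 / 4 * v - 5 / 16)) < 0 := by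
      nlinarith [mul_nonneg (by linarith : 0 ≤ v - 1 / 2) (by linarith : 0 ≤ 3 / 4 - v),
        sq_nonneg (v - 3 / 4)]
    nlinarith [mul_le_mul_of_nonneg_left hconvex hA]
  · rw [max_eq_left h]
    have hconvex : u ^ 2 + v ^ 2 + v * (v - u - 1 / 4) ≤ 2 * v ^ 2 - v / 2 + 1 / 16 := by
      nlinarith
    have hendpoint : 16 - 16 * v + (7 - 5 * v) ^ 2 / 3
        - 2 * (7 - 5 * v) * (2 - (2 * v ^ 2 - v / 2 + 1 / 16)) < 0 := by
      nlinarith [sq_nonneg (v - 17 / 20), mul_nonneg hA (sq_nonneg (v - 17 / 20))]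
    nlinarith [mul_le_mul_of_nonneg_left hconvex hA]

theorem linearFit_lt (hu : 1 / 4 ≤ u) (hv : v ≤ 1) (hh : 0 ≤ h) (hstep : h ≤ v - u - 1 / 4) :
    ((7 - 5 * v) / 4) ^ 2 / 3 - (7 - 5 * v) / 4 * (2 - secondMomentBound u v h) / 2
      + (1 - v + (v - u - h) / 4) < 1 / 16 := by
  -- The left-hand side is nondecreasing in `h`, so the largest admissible `h` is the worst case.
  have hslope : 2 ≤ (7 - 5 * v) * max v (1 - u) := calc
    2 ≤ (7 - 5 * v) * v := by nlinarith
    _ ≤ (7 - 5 * v) * max v (1 - u) :=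
      mul_le_mul_of_nonneg_left (le_max_left _ _) (by linarith)
  have hextremal := linearFit_extremal_lt hu (by linarith) hv
  unfold secondMomentBound at *
  nlinarith [mul_nonneg (sub_nonneg.2 hstep) (sub_nonneg.2 hslope)]

theorem sqrtFit_extremal_lt (hu : 0 ≤ u) (hu' : u ≤ 1 / 4) (huv : u + 1 / 4 ≤ v) (hv : v ≤ 1) :
    ((7 - 4 * v) / 5) ^ 2 / 2 - 4 / 3 * ((7 - 4 * v) / 5)
        * (1 - (u + v) / 5 - 5 / 16 * secondMomentBound u v (min (2 * u) (v - u - 1 / 4)))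
      + (1 - v + (v - u - min (2 * u) (v - u - 1 / 4)) / 4) < 1 / 16 := by
  have hA : 0 ≤ 7 - 4 * v := by linarith
  have hv1 : 0 ≤ 1 - v := by linarith
  have hgap : 0 ≤ v - u - 1 / 4 := by linarith
  unfold secondMomentBound
  rcases le_total (2 * u) (v - u - 1 / 4) with hc | hc
  · rw [min_eq_left hc]
    rcases le_total v (1 - u) with hvu | hvu
    · rw [max_eq_right hvu]
      nlinarith [mul_nonneg hv1 (sub_nonneg.2 hc), mul_nonneg hA (sq_nonneg (u - 1 / 10)),
        sq_nonneg (v - 1 / 2), mul_nonneg hA (sq_nonneg (v - 1 / 2)),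
        mul_nonneg hA (sq_nonneg (v - 3 / 4)), mul_nonneg hv1 (sq_nonneg (v - 1 / 2))]
    · rw [max_eq_left hvu]
      nlinarith [mul_nonneg hv1 hu, mul_nonneg hv1 (sub_nonneg.2 hu'),
        mul_nonneg hA (mul_nonneg hu (sub_nonneg.2 hu')), mul_nonneg (sq_nonneg (1 - v)) hu,
        mul_nonneg hv1 (sub_nonneg.2 hvu)]
  · rw [min_eq_right hc]
    rcases le_total v (1 - u) with hvu | hvu
    · rw [max_eq_right hvu]
      nlinarith [mul_nonneg hgap (sub_nonneg.2 hc),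
        mul_nonneg hA (mul_nonneg hgap (sub_nonneg.2 hc)), sq_nonneg (v - 1 / 2)]
    · rw [max_eq_left hvu]
      nlinarith [mul_nonneg hgap (sub_nonneg.2 hc),
        mul_nonneg hA (mul_nonneg hgap (sub_nonneg.2 hc)), sq_nonneg (v - 1 / 2)]

theorem sqrtFit_lt (hu : 0 ≤ u) (hu' : u ≤ 1 / 4) (hv : v ≤ 1) (hh : 0 ≤ h)
    (hconst : h ≤ 2 * u) (hstep : h ≤ v - u - 1 / 4) :
    ((7 - 4 * v) / 5) ^ 2 / 2
        - 4 / 3 * ((7 - 4 * v) / 5) * (1 - (u + v) / 5 - 5 / 16 * secondMomentBound u v h)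
      + (1 - v + (v - u - h) / 4) < 1 / 16 := by
  have hκ : 3 / 4 ≤ max v (1 - u) := le_max_of_le_right (by linarith)
  have hslope : 3 ≤ (7 - 4 * v) * max v (1 - u) := by
    rcases le_total v (3 / 4) with hv' | hv'
    · nlinarith
    · nlinarith [le_max_left v (1 - u)]
  have hextremal := sqrtFit_extremal_lt hu hu' (by linarith) hv
  unfold secondMomentBound at *
  nlinarith [mul_nonneg (sub_nonneg.2 (le_min hconst hstep)) (sub_nonneg.2 hslope)]

end Amplitudes

theorem exists_median {g : ℝ → ℝ} (hg : g ∈ monotoneClass) :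
    ∃ s ∈ Icc (0 : ℝ) 1, 0 < s ∧ g s = 1 / 2 := by
  obtain ⟨hcont, -, h0, h1⟩ := hg
  obtain ⟨s, hs, hgs⟩ : (1 / 2 : ℝ) ∈ g '' Icc 0 1 :=
    intermediate_value_Icc zero_le_one hcont (by rw [h0, h1]; constructor <;> norm_num)
  have hs_ne : 0 ≠ s := by
    rintro rfl
    norm_num [h0] at hgs
  exact ⟨s, hs, hs.1.lt_of_ne hs_ne, hgs⟩

theorem exists_kumaraswamyError_lt {g : ℝ → ℝ} (hg : g ∈ monotoneClass) :
    ∃ a b c : ℝ, 0 < a ∧ 0 < b ∧ 0 < c ∧ kumaraswamyError g a b c < 1 / 16 := by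
  obtain ⟨s, hs, hs_pos, hgs⟩ := exists_median hg
  have hu := (lowerHalfMean_mem_Icc hg hs hgs).1
  have hv := (upperHalfMean_mem_Icc hg hs hgs).2
  have hh := halvesGini_nonneg hg hs hgs
  have hmoment := two_sub_secondMomentBound_le hg hs hgs
  have hmean := integral_eq_halfMeans hg.1 hs
  have hsq := integral_sq_eq_halves hg.1 hs
  have hsqrt := le_integral_sqrt_mul_of_median hg hs hgs (r := 4 / 5) (by norm_num)
  have hstep_error := integral_step_sub_sq hg.1 hs
  set u := lowerHalfMean g s
  set v := upperHalfMean g s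
  set h := halvesGini g s
  rcases lt_or_ge (v - u - h) (1 / 4) with hstep | hstep
  · exact (isKumaraswamyLimit_step hs_pos).exists_kumaraswamyError_lt hg (by linarith)
  rcases lt_or_ge (2 * u) h with hconst | hconst
  · refine exists_kumaraswamyError_lt_of_mul_rpow hg (A := 1 - (u + v) / 2) (k := 0)
      (by linarith) le_rfl ?_
    rw [integral_mul_rpow_sub_sq hg.1 _ le_rfl, hsq]
    simp only [Real.rpow_zero, one_mul, hmean]
    nlinarith [sq_nonneg (1 - 2 * u - 2 * v)]
  rcases le_total u (1 / 4) with hu' | hu'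
  · have hA : 0 < (7 - 4 * v) / 5 := by linarith
    refine exists_kumaraswamyError_lt_of_mul_rpow hg (k := 1 / 2) hA (by norm_num) ?_
    rw [integral_mul_rpow_sub_sq hg.1 _ (by norm_num), hsq]
    simp only [← Real.sqrt_eq_rpow]
    linarith [mul_le_mul_of_nonneg_left hsqrt hA.le,
      sqrtFit_lt hu hu' hv hh hconst (by linarith)]
  · have hA : 0 < (7 - 5 * v) / 4 := by linarith
    refine exists_kumaraswamyError_lt_of_mul_rpow hg (k := 1) hA zero_le_one ?_
    rw [integral_mul_rpow_sub_sq hg.1 _ zero_le_one, hsq]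
    simp only [Real.rpow_one]
    linarith [mul_le_mul_of_nonneg_left hmoment hA.le, linearFit_lt hu' hv hh (by linarith)]

/-- The supremum over `g` and the infimum over the parameters are taken in `EReal`, so that they
are genuine; moreover, for each `g` the bound is reached by some parameters. -/
theorem mainTheorem6 :
    (⨆ g ∈ monotoneClass, ⨅ (a : ℝ) (_ : 0 < a) (b : ℝ) (_ : 0 < b) (c : ℝ) (_ : 0 < c),
        ((kumaraswamyError g a b c : ℝ) : EReal)) ≤ ((1 / 16 : ℝ) : EReal) ∧
      ∀ g ∈ monotoneClass, ∃ a b c : ℝ, 0 < a ∧ 0 < b ∧ 0 < c ∧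
        kumaraswamyError g a b c ≤ 1 / 16 := by
  have hfit {g : ℝ → ℝ} (hg : g ∈ monotoneClass) :
      ∃ a b c : ℝ, 0 < a ∧ 0 < b ∧ 0 < c ∧ kumaraswamyError g a b c ≤ 1 / 16 := by
    obtain ⟨a, b, c, ha, hb, hc, hlt⟩ := exists_kumaraswamyError_lt hg
    exact ⟨a, b, c, ha, hb, hc, hlt.le⟩
  refine ⟨iSup₂_le fun g hg => ?_, fun g hg => hfit hg⟩
  obtain ⟨a, b, c, ha, hb, hc, hle⟩ := hfit hg
  exact (iInf₂_le a ha).trans <| (iInf₂_le b hb).trans <| (iInf₂_le c hc).trans <|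
    EReal.coe_le_coe_iff.2 hle
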